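/- Let $\mathbb K$ be $\mathbb R$ or $\mathbb C$, let $D\subseteq\mathbb K$ contain $0$ as a non-isolated point (for example $D=\mathbb R$ or $D=[0,\infty)$ for $\mathbb K=\mathbb R$), and let $A(\rho)\in\mathbb C^{m\times m}$ be a family of matrices with a full asymptotic expansion $A(\rho)\sim A_0+\rho A_1+\rho^2A_2+\cdots$ as $\rho\to0$ in $D$, that is, $A(\rho)=\sum_{j=0}^N\rho^jA_j+\mathcal O(\rho^{N+1})$ for all $N$. **Uniform diagonability.** $A$ is uniformly diagonable on a set $S$ if there are invertible matrices $T(\rho)$, $\rho\in S$, continuous in $\rho$, with $\sup_{\rho\in S}\|T(\rho)\|<\infty$, such that $T(\rho)^{-1}A(\rho)T(\rho)$ is diagonal for every $\rho\in S$. A matrix is diagonable if it has a diagonaliser, i.e. an invertible $M$ such that $M^{-1}XM$ is diagonal. **The diagonalisation scheme.** Put $\tilde\Lambda_0=A_0$. If $A_0$ is diagonable, choose a diagonaliser $M_0$ of $A_0$ that arranges equal eigenvalues at consecutive positions, and put $\tilde A^{[0]}(\rho)=M_0^{-1}A(\rho)M_0$. Suppose that after $k\ge0$ steps a family $$\tilde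 A^{[k]}(\rho)\sim\Lambda_0+\rho\Lambda_1+\cdots+\rho^k\Lambda_k+\rho^{k+1}\tilde A^{[k]}_{k+1}+\cdots$$ has been obtained, with diagonal matrices $\Lambda_l=\operatorname{diag}(\lambda^{[l]}_1,\dots,\lambda^{[l]}_m)$, $l\le k$. For $l\le k$ write $i\sim_{\Pi_l}j$ if $\lambda_i^{[l']}=\lambda_j^{[l']}$ for all $l'\le l$, call a matrix $X$ $\Pi_l$-block-diagonal if $X_{ij}=0$ whenever $i\not\sim_{\Pi_l}j$, and let $\operatorname{bdiag}_{\Pi_l}X$ be the matrix obtained from $X$ by replacing the entries with $i\not\sim_{\Pi_l}j$ by $0$. Put $A^{[k,0]}_{k+1}=\operatorname{bdiag}_{\Pi_0}\tilde A^{[k]}_{k+1}$ and $A^{[k,\ell]}_{k+1}=\operatorname{bdiag}_{\Pi_\ell}A^{[k,\ell-1]}_{k+1}$ for $1\le\ell\le k$, and $$\tilde\Lambda_{k+1}=A^{[k,k]}_{k+1}.$$ Choose solutions $K^{[k]}_\ell$ of the Sylvester equations $$[\Lambda_0,K^{[k]}_0]+\tilde A^{[k]}_{k+1}-A^{[k,0]}_{k+1}=0,\qquad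 [\Lambda_\ell,K^{[k]}_\ell]+A^{[k,\ell-1]}_{k+1}-A^{[k,\ell]}_{k+1}=0\quad(1\le\ell\le k),$$ where $K^{[k]}_\ell$ is $\Pi_{\ell-1}$-block-diagonal for $\ell\ge1$. If $\tilde\Lambda_{k+1}$ is diagonable, choose a $\Pi_k$-block-diagonal diagonaliser $M$ of $\tilde\Lambda_{k+1}$, arranged such that the blocks of the refined partition $\Pi_{k+1}$ consist of consecutive indices. With $Q(\rho)=(I+\rho^{k+1}K^{[k]}_0)(I+\rho^kK^{[k]}_1)\cdots(I+\rho K^{[k]}_k)\,M$, put $\tilde A^{[k+1]}(\rho)=Q(\rho)^{-1}\tilde A^{[k]}(\rho)Q(\rho)$ for small $\rho$, and continue. **Assumption $(A_n)$.** The matrices $\tilde\Lambda_0,\tilde\Lambda_1,\dots,\tilde\Lambda_n$ are all diagonable; precisely, for every $k\le n$ the scheme can be carried out up to the definition of $\tilde\Lambda_k$, and, whichever choices were made in the earlier steps, $\tilde\Lambda_k$ is diagonable. **Lemma.** Let $\varepsilon>0$ and assume that $A$ is uniformly diagonable on $\{\rho\in D:|\rho|<\varepsilon\}$ (which includes $\rho=0$).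 Then $A$ satisfies Assumption $(A_n)$ for every $n\in\mathbb N$. -/

import Mathlib

open Filter Topology Asymptotics
open scoped Matrix.Norms.L2Operator

section

variable {𝕜 : Type*} [RCLike 𝕜] [NormedAlgebra 𝕜 ℂ] {m : ℕ}

/-- The family `F` has, for the parameter `ρ` tending to `0` within `D`, the full asymptotic
expansion `F(ρ) ∼ c 0 + ρ c 1 + ρ² c 2 + ⋯`. -/
def HasAsympExpansion (D : Set 𝕜) (F : 𝕜 → Matrix (Fin m) (Fin m) ℂ)
    (c : ℕ → Matrix (Fin m) (Fin m) ℂ) : Prop :=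
  ∀ N : ℕ, (fun ρ : 𝕜 => F ρ - ∑ j ∈ Finset.range (N + 1), ρ ^ j • c j)
    =O[𝓝[D] 0] (fun ρ : 𝕜 => ρ ^ (N + 1))

/-- The matrix `M` is a diagonaliser of `X`. -/
def IsDiagonaliser (M X : Matrix (Fin m) (Fin m) ℂ) : Prop :=
  IsUnit M ∧ (M⁻¹ * X * M).IsDiag

/-- The matrix `X` is diagonable (diagonalisable over `ℂ`). -/
def Diagonable (X : Matrix (Fin m) (Fin m) ℂ) : Prop :=
  ∃ M, IsDiagonaliser M X

/-- The family `A` is uniformly diagonable on `S`: there are invertible matrices `T(ρ)`, continuous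
in `ρ ∈ S` and uniformly bounded in norm, such that `T(ρ)⁻¹ A(ρ) T(ρ)` is diagonal. -/
def UniformlyDiagonableOn (S : Set 𝕜) (A : 𝕜 → Matrix (Fin m) (Fin m) ℂ) : Prop :=
  ∃ T : 𝕜 → Matrix (Fin m) (Fin m) ℂ,
    ContinuousOn T S ∧ (∀ ρ ∈ S, IsDiagonaliser (T ρ) (A ρ)) ∧ ∃ C : ℝ, ∀ ρ ∈ S, ‖T ρ‖ ≤ C

/-- The equivalence relation `i ∼ j` of the partition `Π_k`. At a stage where `c 0, …, c k` are the
diagonal matrices `Λ_0, …, Λ_k`, it says that `λ_i^{[l]} = λ_j^{[l]}` for all `l ≤ k`. -/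
def SameBlock (c : ℕ → Matrix (Fin m) (Fin m) ℂ) (k : ℕ) (i j : Fin m) : Prop :=
  ∀ l ≤ k, c l i i = c l j j

open Classical in
/-- The block-diagonal part of `X` with respect to the equivalence relation `r`. -/
noncomputable def bdiag (r : Fin m → Fin m → Prop) (X : Matrix (Fin m) (Fin m) ℂ) :
    Matrix (Fin m) (Fin m) ℂ :=
  Matrix.of fun i j => if r i j then X i j else 0

/-- The matrix `X` is block-diagonal with respect to the equivalence relation `r`. -/
def IsBlockDiag (r : Fin m → Fin m → Prop) (X : Matrix (Fin m) (Fin m) ℂ) : Prop :=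
  ∀ i j, ¬ r i j → X i j = 0

/-- The eigenvalues are arranged in groups: the blocks of `Π_k` consist of consecutive indices. -/
def Grouped (c : ℕ → Matrix (Fin m) (Fin m) ℂ) (k : ℕ) : Prop :=
  ∀ i l j : Fin m, i ≤ l → l ≤ j → SameBlock c k i j → SameBlock c k i l

/-- The matrices `A^{[k,ℓ]}_{k+1}` of the sub-steps `ℓ = 0, 1, …, k`, computed from the
coefficients `c` of the family at stage `k`. -/
noncomputable def subStep (c : ℕ → Matrix (Fin m) (Fin m) ℂ) (k : ℕ) :
    ℕ → Matrix (Fin m) (Fin m) ℂ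
  | 0 => bdiag (SameBlock c 0) (c (k + 1))
  | l + 1 => bdiag (SameBlock c (l + 1)) (subStep c k l)

/-- The matrix `Λ̃_{k+1} = A^{[k,k]}_{k+1}`, computed from the coefficients `c` of the family at
stage `k`. -/
noncomputable def lambdaTilde (c : ℕ → Matrix (Fin m) (Fin m) ℂ) (k : ℕ) :
    Matrix (Fin m) (Fin m) ℂ :=
  subStep c k k

/-- The matrices `K 0, …, K k` solve the Sylvester equations of the sub-steps at stage `k`, and
`K ℓ` is `Π_{ℓ-1}`-block-diagonal for `ℓ = 1, …, k`. -/
def SolvesSylvester (c : ℕ → Matrix (Fin m) (Fin m) ℂ) (k : ℕ)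
    (K : ℕ → Matrix (Fin m) (Fin m) ℂ) : Prop :=
  (c 0 * K 0 - K 0 * c 0 + c (k + 1) - subStep c k 0 = 0) ∧
  ∀ l < k, IsBlockDiag (SameBlock c l) (K (l + 1)) ∧
    c (l + 1) * K (l + 1) - K (l + 1) * c (l + 1) + subStep c k l - subStep c k (l + 1) = 0

/-- The transformation `(I + ρ^{k+1} K_0) (I + ρ^k K_1) ⋯ (I + ρ K_k)`. -/
noncomputable def stepTransform (K : ℕ → Matrix (Fin m) (Fin m) ℂ) (k : ℕ) (ρ : 𝕜) :
    Matrix (Fin m) (Fin m) ℂ :=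
  ((List.range (k + 1)).map fun l => 1 + ρ ^ (k + 1 - l) • K l).prod

/-- `SchemeStage D A a k F c`: some admissible execution of the first `k` steps of the scheme, applied
to the family `A` with coefficients `a`, leads to the family `F = Ã^{[k]}` with the coefficients
`c`, so that `c 0 = Λ_0, …, c k = Λ_k` are diagonal. All choices of diagonalisers and of solutions of
the Sylvester equations that the scheme leaves open are admitted. -/
inductive SchemeStage (D : Set 𝕜) (A : 𝕜 → Matrix (Fin m) (Fin m) ℂ)
    (a : ℕ → Matrix (Fin m) (Fin m) ℂ) :
    ℕ → (𝕜 → Matrix (Fin m) (Fin m) ℂ) → (ℕ → Matrix (Fin m) (Fin m) ℂ) → Prop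
  | zero (M : Matrix (Fin m) (Fin m) ℂ) (c : ℕ → Matrix (Fin m) (Fin m) ℂ)
      (hM : IsDiagonaliser M (a 0))
      (hc : HasAsympExpansion D (fun ρ => M⁻¹ * A ρ * M) c)
      (hg : Grouped c 0) :
      SchemeStage D A a 0 (fun ρ => M⁻¹ * A ρ * M) c
  | succ (k : ℕ) (F : 𝕜 → Matrix (Fin m) (Fin m) ℂ) (c : ℕ → Matrix (Fin m) (Fin m) ℂ)
      (hF : SchemeStage D A a k F c)
      (K : ℕ → Matrix (Fin m) (Fin m) ℂ) (M : Matrix (Fin m) (Fin m) ℂ)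
      (c' : ℕ → Matrix (Fin m) (Fin m) ℂ)
      (hK : SolvesSylvester c k K)
      (hM : IsDiagonaliser M (lambdaTilde c k))
      (hMb : IsBlockDiag (SameBlock c k) M)
      (hc' : HasAsympExpansion D
        (fun ρ => (stepTransform K k ρ * M)⁻¹ * F ρ * (stepTransform K k ρ * M)) c')
      (hg : Grouped c' (k + 1)) :
      SchemeStage D A a (k + 1)
        (fun ρ => (stepTransform K k ρ * M)⁻¹ * F ρ * (stepTransform K k ρ * M)) c'

/-- The matrix `L` is a matrix `Λ̃_k` of the family: `Λ̃_0 = A_0`, and `Λ̃_{k+1}` is computed after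
some admissible execution of the first `k` steps of the scheme. -/
def IsLambdaTilde (D : Set 𝕜) (A : 𝕜 → Matrix (Fin m) (Fin m) ℂ)
    (a : ℕ → Matrix (Fin m) (Fin m) ℂ) : ℕ → Matrix (Fin m) (Fin m) ℂ → Prop
  | 0, L => L = a 0
  | k + 1, L => ∃ F c, SchemeStage D A a k F c ∧ L = lambdaTilde c k

/-- Assumption (A_n): for `k = 0, …, n` the scheme can be executed far enough to produce `Λ̃_k`, and
`Λ̃_k` is diagonable, whichever admissible choices were made on the way. -/
def AssumptionA (D : Set 𝕜) (A : 𝕜 → Matrix (Fin m) (Fin m) ℂ)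
    (a : ℕ → Matrix (Fin m) (Fin m) ℂ) (n : ℕ) : Prop :=
  ∀ k ≤ n, (∃ L, IsLambdaTilde D A a k L) ∧ ∀ L, IsLambdaTilde D A a k L → Diagonable L

end

/-!
The matrices that diagonalise the family converge, as `ρ → 0`, to an invertible matrix, and each step
of the scheme conjugates the family by a transformation which is analytic near `0` with invertible
value there. So at every stage the transformed family `F` still has diagonalisers `T(ρ)` with an
invertible limit `T₀` (`SchemeStage.invariant`), and `F ∼ Λ_0 + ⋯ + ρ^k Λ_k + ρ^{k+1} c_{k+1} + ⋯` with
diagonal `Λ_0, …, Λ_k` (`step_coeff`, by uniqueness of asymptotic expansions).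

The point is that this single matrix `T₀` diagonalises `Λ̃_{k+1}`
(`HasConvergentDiagonaliser.exists_lambdaTilde_mul_eq`). If `d_j(ρ)` is the eigenvalue belonging to
column `j`, then row `i` of the eigenvalue equation reads
`(d_j(ρ) - ∑_{l ≤ k} ρ^l λ_i^{[l]}) T(ρ)_{ij} = ρ^{k+1} (c_{k+1} T₀)_{ij} + o(ρ^{k+1})`.
If `(T₀)_{ij} ≠ 0`, this determines `d_j(ρ)` up to `O(ρ^{k+1})`, so two rows with this property have the
same `λ^{[0]}, …, λ^{[k]}`: column `j` of `T₀` is supported in one block of `Π_k`. Inside this block the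
bracket does not depend on `i`, and after division by `ρ^{k+1}` the limit `ρ → 0` says that the column
is an eigenvector of the block-diagonal part of `c_{k+1}`, which is `Λ̃_{k+1}`.

That the scheme can be carried on (`exists_schemeStage`) rests on the entrywise solution of the
Sylvester equations and on a permutation of the columns of `T₀` which makes it block-diagonal and
groups the eigenvalues (`exists_blockDiag_diagonaliser`).
-/

/-! ### Asymptotic expansions -/

section Expansions

variable {𝕜 : Type*} [RCLike 𝕜] [NormedAlgebra 𝕜 ℂ] {m : ℕ}

/-- The spectral norm makes the complex matrices a normed algebra also over the field of the
parameter; the underlying scalar multiplication is the entrywise one. -/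
noncomputable instance matrixNormedAlgebra :
    NormedAlgebra 𝕜 (Matrix (Fin m) (Fin m) ℂ) where
  norm_smul_le r X := by
    rw [← algebraMap_smul ℂ r X]
    exact (norm_smul_le _ _).trans (by rw [norm_algebraMap'])

/-- Within a set that accumulates at `0`, the coefficients of an asymptotic polynomial are unique. -/
lemma eq_zero_of_sum_pow_smul_isBigO {K : Type*} [NormedField K] {E : Type*}
    [NormedAddCommGroup E] [NormedSpace K E] {D : Set K} (hD : AccPt (0 : K) (𝓟 D)) (n : ℕ) :
    ∀ b : ℕ → E, (fun ρ : K => ∑ j ∈ Finset.range n, ρ ^ j • b j)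
      =O[𝓝[≠] 0 ⊓ 𝓟 D] (fun ρ => ρ ^ n) → ∀ j < n, b j = 0 := by
  have : (𝓝[≠] (0 : K) ⊓ 𝓟 D).NeBot := hD
  have hle : 𝓝[≠] (0 : K) ⊓ 𝓟 D ≤ 𝓝 0 := inf_le_left.trans nhdsWithin_le_nhds
  have hne : ∀ᶠ ρ in 𝓝[≠] (0 : K) ⊓ 𝓟 D, ρ ≠ 0 :=
    mem_inf_of_left self_mem_nhdsWithin
  induction n with
  | zero => intro b _ j hj; omega
  | succ n ih =>
    intro b hb
    have hb0 : b 0 = 0 := by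
      have hlim : Tendsto (fun ρ : K => ∑ j ∈ Finset.range (n + 1), ρ ^ j • b j)
          (𝓝[≠] (0 : K) ⊓ 𝓟 D) (𝓝 (b 0)) := by
        have hc : Continuous fun ρ : K => ∑ j ∈ Finset.range (n + 1), ρ ^ j • b j := by
          fun_prop
        have := hc.tendsto 0
        rw [Finset.sum_range_succ'] at this
        simp only [pow_zero, one_smul, ne_eq, Nat.add_eq_zero_iff, one_ne_zero, and_false,
          not_false_eq_true, zero_pow, zero_smul, Finset.sum_const_zero, zero_add] at this
        exact this.mono_left hle
      refine tendsto_nhds_unique hlim (hb.trans_tendsto ?_)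
      have : Tendsto (fun ρ : K => ρ ^ (n + 1)) (𝓝 0) (𝓝 0) := by
        simpa using (continuous_pow (n + 1)).tendsto (0 : K)
      exact this.mono_left hle
    -- With `b 0 = 0` known, division by `ρ` lowers the degree.
    have hshift : ∀ j < n, b (j + 1) = 0 := by
      apply ih
      have h1 := (isBigO_refl (fun ρ : K => ρ⁻¹) (𝓝[≠] (0 : K) ⊓ 𝓟 D)).smul hb
      refine h1.congr' ?_ ?_
      · filter_upwards [hne] with ρ hρ
        rw [Finset.sum_range_succ', hb0, smul_zero, add_zero, Finset.smul_sum]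
        refine Finset.sum_congr rfl fun j _ => ?_
        rw [smul_smul, pow_succ', inv_mul_cancel_left₀ hρ]
      · filter_upwards [hne] with ρ hρ
        rw [smul_eq_mul, pow_succ', inv_mul_cancel_left₀ hρ]
    intro j hj
    cases j with
    | zero => exact hb0
    | succ j => exact hshift j (by omega)

lemma pow_isBigO_pow {K : Type*} [NormedField K] {D : Set K} {p q : ℕ} (h : q ≤ p) :
    (fun ρ : K => ρ ^ p) =O[𝓝[D] 0] (fun ρ => ρ ^ q) := by
  have h1 : (fun ρ : K => ρ ^ (p - q)) =O[𝓝[D] 0] (fun _ => (1 : K)) :=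
    ((continuous_pow (p - q)).tendsto (0 : K)).isBigO_one K |>.mono nhdsWithin_le_nhds
  have := h1.mul (isBigO_refl (fun ρ : K => ρ ^ q) (𝓝[D] 0))
  refine this.congr (fun ρ => ?_) (fun ρ => one_mul _)
  rw [← pow_add, Nat.sub_add_cancel h]

lemma pow_smul_isBigO_pow {D : Set 𝕜} {p q : ℕ} (h : q ≤ p) (X : Matrix (Fin m) (Fin m) ℂ) :
    (fun ρ : 𝕜 => ρ ^ p • X) =O[𝓝[D] 0] (fun ρ => ρ ^ q) := by
  have h2 : (fun _ : 𝕜 => X) =O[𝓝[D] 0] (fun _ => (1 : 𝕜)) := isBigO_const_const _ one_ne_zero _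
  simpa using (pow_isBigO_pow (D := D) h).smul h2

lemma HasAsympExpansion.eq_of_isBigO {D : Set 𝕜} (hD : AccPt (0 : 𝕜) (𝓟 D))
    {F : 𝕜 → Matrix (Fin m) (Fin m) ℂ} {c b : ℕ → Matrix (Fin m) (Fin m) ℂ}
    (hF : HasAsympExpansion D F c) {n : ℕ}
    (hb : (fun ρ : 𝕜 => F ρ - ∑ j ∈ Finset.range (n + 1), ρ ^ j • b j)
      =O[𝓝[D] 0] (fun ρ => ρ ^ (n + 1))) {j : ℕ} (hj : j ≤ n) : c j = b j := by
  have h := hb.sub (hF n)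
  have h2 : (fun ρ : 𝕜 => ∑ j ∈ Finset.range (n + 1), ρ ^ j • (c j - b j))
      =O[𝓝[D] 0] (fun ρ => ρ ^ (n + 1)) := by
    refine h.congr_left fun ρ => ?_
    simp only [smul_sub, Finset.sum_sub_distrib]
    abel
  have hle : 𝓝[≠] (0 : 𝕜) ⊓ 𝓟 D ≤ 𝓝[D] 0 := inf_le_inf_right _ nhdsWithin_le_nhds
  exact sub_eq_zero.1 (eq_zero_of_sum_pow_smul_isBigO hD _ _ (h2.mono hle) j (by omega))

lemma HasAsympExpansion.tendsto {D : Set 𝕜}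
    {F : 𝕜 → Matrix (Fin m) (Fin m) ℂ} {c : ℕ → Matrix (Fin m) (Fin m) ℂ}
    (hF : HasAsympExpansion D F c) : Tendsto F (𝓝[D] 0) (𝓝 (c 0)) := by
  have h := (hF 0).trans_tendsto (g'' := fun ρ : 𝕜 => ρ ^ (0 + 1)) (by
    simp only [zero_add, pow_one]
    exact tendsto_id'.2 nhdsWithin_le_nhds)
  simpa using h.add_const (c 0)

lemma HasAsympExpansion.isBigO_one {D : Set 𝕜}
    {F : 𝕜 → Matrix (Fin m) (Fin m) ℂ} {c : ℕ → Matrix (Fin m) (Fin m) ℂ}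
    (hF : HasAsympExpansion D F c) : F =O[𝓝[D] 0] (fun _ => (1 : 𝕜)) :=
  hF.tendsto.isBigO_one 𝕜

lemma sum_antidiagonal_eq_sum_product {E : Type*} [AddCommMonoid E] (N : ℕ) (f : ℕ × ℕ → E) :
    ∑ n ∈ Finset.range (N + 1), ∑ p ∈ Finset.HasAntidiagonal.antidiagonal n, f p =
      ∑ p ∈ Finset.range (N + 1) ×ˢ Finset.range (N + 1) with (p.1 + p.2 < N + 1), f p := by
  rw [← Finset.sum_fiberwise_of_maps_to (t := Finset.range (N + 1)) (g := fun p : ℕ × ℕ => p.1 + p.2)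
    (by simp +contextual)]
  refine Finset.sum_congr rfl fun n hn => Finset.sum_congr ?_ fun _ _ => rfl
  ext p
  simp only [Finset.mem_range, Finset.HasAntidiagonal.mem_antidiagonal, Finset.mem_filter,
    Finset.mem_product] at hn ⊢
  omega

/-- The coefficients of a product are the Cauchy products of the coefficients. -/
lemma HasAsympExpansion.mul {D : Set 𝕜}
    {F G : 𝕜 → Matrix (Fin m) (Fin m) ℂ} {c d : ℕ → Matrix (Fin m) (Fin m) ℂ}
    (hF : HasAsympExpansion D F c) (hG : HasAsympExpansion D G d) :
    HasAsympExpansion D (fun ρ => F ρ * G ρ)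
      (fun n => ∑ p ∈ Finset.HasAntidiagonal.antidiagonal n, c p.1 * d p.2) := by
  intro N
  set P : 𝕜 → Matrix (Fin m) (Fin m) ℂ := fun ρ => ∑ j ∈ Finset.range (N + 1), ρ ^ j • c j with hP
  set R : 𝕜 → Matrix (Fin m) (Fin m) ℂ := fun ρ => ∑ j ∈ Finset.range (N + 1), ρ ^ j • d j with hR
  have hP1 : P =O[𝓝[D] 0] (fun _ => (1 : 𝕜)) := by
    have hc : Continuous P := by fun_prop
    exact ((hc.tendsto 0).mono_left nhdsWithin_le_nhds).isBigO_one 𝕜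
  have h1 : (fun ρ => (F ρ - P ρ) * G ρ) =O[𝓝[D] 0] (fun ρ : 𝕜 => ρ ^ (N + 1)) := by
    simpa using (hF N).mul hG.isBigO_one
  have h2 : (fun ρ => P ρ * (G ρ - R ρ)) =O[𝓝[D] 0] (fun ρ : 𝕜 => ρ ^ (N + 1)) := by
    simpa using hP1.mul (hG N)
  -- The terms of the product of the two partial sums whose degree exceeds `N`.
  have h3 : (∑ p ∈ Finset.range (N + 1) ×ˢ Finset.range (N + 1) with ¬ p.1 + p.2 < N + 1,
      fun ρ : 𝕜 => ρ ^ (p.1 + p.2) • (c p.1 * d p.2)) =O[𝓝[D] 0] (fun ρ : 𝕜 => ρ ^ (N + 1)) := by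
    refine IsBigO.sum fun p hp => pow_smul_isBigO_pow ?_ _
    exact not_lt.1 (Finset.mem_filter.1 hp).2
  refine ((h1.add h2).add h3).congr_left fun ρ => ?_
  have hPR : P ρ * R ρ = ∑ p ∈ Finset.range (N + 1) ×ˢ Finset.range (N + 1),
      ρ ^ (p.1 + p.2) • (c p.1 * d p.2) := by
    rw [hP, hR]
    simp only [Finset.sum_mul_sum, ← Finset.sum_product', smul_mul_smul_comm, pow_add]
  have hsplit := Finset.sum_filter_add_sum_filter_not
    (Finset.range (N + 1) ×ˢ Finset.range (N + 1)) (fun p => p.1 + p.2 < N + 1)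
    (fun p => ρ ^ (p.1 + p.2) • (c p.1 * d p.2))
  rw [← hPR, ← sum_antidiagonal_eq_sum_product] at hsplit
  have hdeg : ∑ n ∈ Finset.range (N + 1), ∑ p ∈ Finset.HasAntidiagonal.antidiagonal n,
      ρ ^ (p.1 + p.2) • (c p.1 * d p.2) = ∑ n ∈ Finset.range (N + 1),
        ρ ^ n • ∑ p ∈ Finset.HasAntidiagonal.antidiagonal n, c p.1 * d p.2 := by
    refine Finset.sum_congr rfl fun n _ => ?_
    rw [Finset.smul_sum]
    refine Finset.sum_congr rfl fun p hp => ?_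
    rw [Finset.HasAntidiagonal.mem_antidiagonal.1 hp]
  rw [hdeg] at hsplit
  rw [Finset.sum_apply]
  have : F ρ * G ρ = (F ρ - P ρ) * G ρ + P ρ * (G ρ - R ρ) + P ρ * R ρ := by noncomm_ring
  beta_reduce
  rw [this, ← hsplit]
  abel

lemma AnalyticAt.exists_hasAsympExpansion {D : Set 𝕜} {F : 𝕜 → Matrix (Fin m) (Fin m) ℂ}
    (hF : AnalyticAt 𝕜 F 0) : ∃ c, HasAsympExpansion D F c := by
  obtain ⟨p, hp⟩ := hF
  refine ⟨fun n => p.coeff n, fun N => ?_⟩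
  have h := (hp.isBigO_sub_partialSum_pow (N + 1)).mono (nhdsWithin_le_nhds (s := D))
  simp only [← norm_pow] at h
  refine (isBigO_norm_right.1 h).congr_left fun ρ => ?_
  simp [FormalMultilinearSeries.partialSum]

lemma AnalyticAt.matrix_inv {Q : 𝕜 → Matrix (Fin m) (Fin m) ℂ}
    (hQ : AnalyticAt 𝕜 Q 0) (h0 : IsUnit (Q 0)) : AnalyticAt 𝕜 (fun ρ => (Q ρ)⁻¹) 0 := by
  simp only [Matrix.nonsing_inv_eq_ringInverse]
  obtain ⟨u, hu⟩ := h0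
  have := analyticAt_inverse (𝕜 := 𝕜) u
  rw [hu] at this
  exact this.comp hQ

lemma eventually_isUnit_of_tendsto {α : Type*} {l : Filter α}
    {Q : α → Matrix (Fin m) (Fin m) ℂ} {Q₀ : Matrix (Fin m) (Fin m) ℂ}
    (hQ : Tendsto Q l (𝓝 Q₀)) (h0 : IsUnit Q₀) : ∀ᶠ x in l, IsUnit (Q x) :=
  hQ.eventually (Units.isOpen.mem_nhds h0)

end Expansions

/-! ### Block-diagonal matrices and the sub-steps -/

section Blocks

variable {m : ℕ}

lemma bdiag_apply_of_rel {r : Fin m → Fin m → Prop} {i j : Fin m} (h : r i j)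
    (X : Matrix (Fin m) (Fin m) ℂ) : bdiag r X i j = X i j := by simp [bdiag, h]

lemma bdiag_apply_of_not_rel {r : Fin m → Fin m → Prop} {i j : Fin m} (h : ¬ r i j)
    (X : Matrix (Fin m) (Fin m) ℂ) : bdiag r X i j = 0 := by simp [bdiag, h]

lemma SameBlock.refl (c : ℕ → Matrix (Fin m) (Fin m) ℂ) (k : ℕ) (i : Fin m) :
    SameBlock c k i i := fun _ _ => rfl

lemma SameBlock.symm {c : ℕ → Matrix (Fin m) (Fin m) ℂ} {k : ℕ} {i j : Fin m}
    (h : SameBlock c k i j) : SameBlock c k j i := fun l hl => (h l hl).symm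

lemma SameBlock.trans {c : ℕ → Matrix (Fin m) (Fin m) ℂ} {k : ℕ} {i j l : Fin m}
    (h : SameBlock c k i j) (h' : SameBlock c k j l) : SameBlock c k i l :=
  fun n hn => (h n hn).trans (h' n hn)

lemma SameBlock.mono {c : ℕ → Matrix (Fin m) (Fin m) ℂ} {k l : ℕ} {i j : Fin m}
    (h : SameBlock c k i j) (hl : l ≤ k) : SameBlock c l i j := fun n hn => h n (hn.trans hl)

lemma sameBlock_succ_iff {c : ℕ → Matrix (Fin m) (Fin m) ℂ} {k : ℕ} {i j : Fin m} :
    SameBlock c (k + 1) i j ↔ SameBlock c k i j ∧ c (k + 1) i i = c (k + 1) j j := by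
  refine ⟨fun h => ⟨h.mono (Nat.le_succ k), h _ le_rfl⟩, fun h l hl => ?_⟩
  rcases Nat.le_succ_iff.1 hl with hl | rfl
  · exact h.1 l hl
  · exact h.2

/-- As the partitions are nested, the sub-steps amount to a single block truncation. -/
lemma subStep_eq_bdiag (c : ℕ → Matrix (Fin m) (Fin m) ℂ) (k l : ℕ) :
    subStep c k l = bdiag (SameBlock c l) (c (k + 1)) := by
  induction l with
  | zero => rfl
  | succ l ih =>
    ext i j
    rw [subStep, ih]
    by_cases h : SameBlock c (l + 1) i j
    · rw [bdiag_apply_of_rel h, bdiag_apply_of_rel h, bdiag_apply_of_rel (h.mono (Nat.le_succ l))]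
    · rw [bdiag_apply_of_not_rel h, bdiag_apply_of_not_rel h]

lemma Matrix.IsDiag.mul_apply {L : Matrix (Fin m) (Fin m) ℂ} (hL : L.IsDiag)
    (X : Matrix (Fin m) (Fin m) ℂ) (i j : Fin m) : (L * X) i j = L i i * X i j := by
  conv_lhs => rw [← hL.diagonal_diag]
  rw [Matrix.diagonal_mul, Matrix.diag_apply]

lemma Matrix.IsDiag.mul_apply' {L : Matrix (Fin m) (Fin m) ℂ} (hL : L.IsDiag)
    (X : Matrix (Fin m) (Fin m) ℂ) (i j : Fin m) : (X * L) i j = X i j * L j j := by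
  conv_lhs => rw [← hL.diagonal_diag]
  rw [Matrix.mul_diagonal, Matrix.diag_apply]

lemma IsBlockDiag.mul_comm {c : ℕ → Matrix (Fin m) (Fin m) ℂ} {k l : ℕ} (hl : l ≤ k)
    (hc : (c l).IsDiag) {X : Matrix (Fin m) (Fin m) ℂ} (hX : IsBlockDiag (SameBlock c k) X) :
    c l * X = X * c l := by
  ext i j
  rw [hc.mul_apply, hc.mul_apply']
  by_cases h : SameBlock c k i j
  · rw [h l hl, _root_.mul_comm]
  · rw [hX i j h, mul_zero, zero_mul]

/-- The matrix in the place of `ρ^{k+1}` before the `l`-th sub-step of stage `k`. -/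
noncomputable def beforeSubStep (c : ℕ → Matrix (Fin m) (Fin m) ℂ) (k : ℕ) :
    ℕ → Matrix (Fin m) (Fin m) ℂ
  | 0 => c (k + 1)
  | l + 1 => subStep c k l

lemma SolvesSylvester.commutator_eq {c K : ℕ → Matrix (Fin m) (Fin m) ℂ} {k : ℕ}
    (hK : SolvesSylvester c k K) {l : ℕ} (hl : l ≤ k) :
    c l * K l - K l * c l + beforeSubStep c k l - beforeSubStep c k (l + 1) = 0 := by
  cases l with
  | zero => exact hK.1
  | succ l => exact (hK.2 l hl).2

lemma SolvesSylvester.commute {c K : ℕ → Matrix (Fin m) (Fin m) ℂ} {k : ℕ}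
    (hK : SolvesSylvester c k K) {l n : ℕ} (hl : l ≤ k) (hn : n < l) (hc : (c n).IsDiag) :
    c n * K l = K l * c n := by
  cases l with
  | zero => omega
  | succ l => exact (hK.2 l hl).1.mul_comm (Nat.lt_succ_iff.1 hn) hc

/-- The Sylvester equations are solved entry by entry: on the removed entries the two diagonal
entries of `Λ_ℓ` differ, and one divides by their difference. -/
lemma exists_solvesSylvester {c : ℕ → Matrix (Fin m) (Fin m) ℂ} {k : ℕ}
    (hc : ∀ l ≤ k, (c l).IsDiag) : ∃ K, SolvesSylvester c k K := by
  have key : ∀ (L X Y : Matrix (Fin m) (Fin m) ℂ), L.IsDiag →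
      (∀ i j, L i i = L j j → X i j = Y i j) →
      L * (Matrix.of fun i j => (Y i j - X i j) / (L i i - L j j)) -
        (Matrix.of fun i j => (Y i j - X i j) / (L i i - L j j)) * L + X - Y = 0 := by
    intro L X Y hL h
    ext i j
    rw [Matrix.sub_apply, Matrix.add_apply, Matrix.sub_apply, hL.mul_apply, hL.mul_apply',
      Matrix.of_apply, Matrix.zero_apply]
    by_cases hij : L i i = L j j
    · rw [h i j hij]; simp
    · have := sub_ne_zero.2 hij
      field_simp
      ring
  refine ⟨fun l => Matrix.of fun i j =>
    (beforeSubStep c k (l + 1) i j - beforeSubStep c k l i j) / (c l i i - c l j j), ?_, ?_⟩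
  · refine key _ _ _ (hc 0 (Nat.zero_le k)) fun i j hij => ?_
    have h : SameBlock c 0 i j := fun l hl => by rwa [Nat.le_zero.1 hl]
    change c (k + 1) i j = subStep c k 0 i j
    rw [subStep_eq_bdiag, bdiag_apply_of_rel h]
  · intro l hl
    refine ⟨fun i j hij => ?_, key _ _ _ (hc _ hl) fun i j hij => ?_⟩
    · have h' : ¬ SameBlock c (l + 1) i j := fun h => hij (h.mono (Nat.le_succ l))
      simp only [beforeSubStep, Matrix.of_apply, subStep_eq_bdiag]
      rw [bdiag_apply_of_not_rel hij, bdiag_apply_of_not_rel h', sub_zero, zero_div]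
    · change subStep c k l i j = subStep c k (l + 1) i j
      rw [subStep_eq_bdiag, subStep_eq_bdiag]
      by_cases h : SameBlock c l i j
      · rw [bdiag_apply_of_rel h, bdiag_apply_of_rel (sameBlock_succ_iff.2 ⟨h, hij⟩)]
      · have h' : ¬ SameBlock c (l + 1) i j := fun h' => h (h'.mono (Nat.le_succ l))
        rw [bdiag_apply_of_not_rel h, bdiag_apply_of_not_rel h']

end Blocks

/-! ### One step of the scheme -/

section Step

variable {𝕜 : Type*} [RCLike 𝕜] [NormedAlgebra 𝕜 ℂ] {m : ℕ}

/-- The partial products of the transformation intertwine the family with its normal form up to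
`O(ρ^{k+2})`. In the `n`-th factor `K n` commutes with `Λ_0, …, Λ_{n-1}`, its commutator with `Λ_n`
produces the Sylvester equation at order `k + 1`, and all other terms are of higher order. -/
lemma SolvesSylvester.intertwine_isBigO {D : Set 𝕜} {F : 𝕜 → Matrix (Fin m) (Fin m) ℂ}
    {c K : ℕ → Matrix (Fin m) (Fin m) ℂ} {k : ℕ} (hF : HasAsympExpansion D F c)
    (hc : ∀ l ≤ k, (c l).IsDiag) (hK : SolvesSylvester c k K) (n : ℕ) (hn : n ≤ k + 1) :
    (fun ρ : 𝕜 => F ρ * ((List.range n).map fun l => 1 + ρ ^ (k + 1 - l) • K l).prod -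
      ((List.range n).map fun l => 1 + ρ ^ (k + 1 - l) • K l).prod *
        (∑ j ∈ Finset.range (k + 1), ρ ^ j • c j + ρ ^ (k + 1) • beforeSubStep c k n))
      =O[𝓝[D] 0] (fun ρ => ρ ^ (k + 2)) := by
  induction n with
  | zero =>
    refine (hF (k + 1)).congr_left fun ρ => ?_
    simp [Finset.sum_range_succ _ (k + 1), beforeSubStep]
  | succ n ih =>
    have hnk : n ≤ k := by omega
    set S : 𝕜 → Matrix (Fin m) (Fin m) ℂ := fun ρ =>
      ((List.range n).map fun l => 1 + ρ ^ (k + 1 - l) • K l).prod with hS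
    have hScont : Continuous S :=
      continuous_list_prod _ fun l _ => by fun_prop
    have hS1 : S =O[𝓝[D] 0] (fun _ => (1 : 𝕜)) :=
      ((hScont.tendsto 0).mono_left nhdsWithin_le_nhds).isBigO_one 𝕜
    have hf1 : (fun ρ : 𝕜 => 1 + ρ ^ (k + 1 - n) • K n) =O[𝓝[D] 0] (fun _ => (1 : 𝕜)) := by
      have : Continuous (fun ρ : 𝕜 => 1 + ρ ^ (k + 1 - n) • K n) := by fun_prop
      exact ((this.tendsto 0).mono_left nhdsWithin_le_nhds).isBigO_one 𝕜
    have hrest : (fun ρ : 𝕜 =>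
        (∑ j ∈ Finset.range (k + 1), ρ ^ j • c j + ρ ^ (k + 1) • beforeSubStep c k n) *
          (1 + ρ ^ (k + 1 - n) • K n) - (1 + ρ ^ (k + 1 - n) • K n) *
        (∑ j ∈ Finset.range (k + 1), ρ ^ j • c j + ρ ^ (k + 1) • beforeSubStep c k (n + 1)))
        =O[𝓝[D] 0] (fun ρ => ρ ^ (k + 2)) := by
      have h1 : (∑ j ∈ Finset.range (k + 1), fun ρ : 𝕜 => if j = n then 0 else
          ρ ^ (k + 1 - n + j) • (c j * K n - K n * c j))
          =O[𝓝[D] 0] (fun ρ => ρ ^ (k + 2)) := by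
        refine IsBigO.sum fun j hj => ?_
        rcases lt_trichotomy j n with h | h | h
        · rw [hK.commute hnk h (hc j (by omega))]
          simpa using isBigO_zero _ _
        · simpa [h] using isBigO_zero _ _
        · simp only [h.ne', if_false]
          exact pow_smul_isBigO_pow (by omega) _
      have h2 : (fun ρ : 𝕜 => ρ ^ (k + 1 + (k + 1 - n)) •
          (beforeSubStep c k n * K n - K n * beforeSubStep c k (n + 1)))
          =O[𝓝[D] 0] (fun ρ => ρ ^ (k + 2)) := pow_smul_isBigO_pow (by omega) _
      refine (h1.add h2).congr_left fun ρ => ?_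
      have h3 : ∑ j ∈ Finset.range (k + 1), (if j = n then 0 else
          ρ ^ (k + 1 - n + j) • (c j * K n - K n * c j)) =
          ρ ^ (k + 1 - n) • ((∑ j ∈ Finset.range (k + 1), ρ ^ j • c j) * K n -
            K n * ∑ j ∈ Finset.range (k + 1), ρ ^ j • c j) -
          ρ ^ (k + 1) • (c n * K n - K n * c n) := by
        have h4 : ρ ^ (k + 1) • (c n * K n - K n * c n) = ∑ j ∈ Finset.range (k + 1),
            if j = n then ρ ^ (k + 1 - n + j) • (c j * K n - K n * c j) else 0 := by
          rw [Finset.sum_ite_eq' , if_pos (Finset.mem_range.2 (by omega)),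
            Nat.sub_add_cancel (by omega)]
        rw [h4, eq_sub_iff_add_eq, ← Finset.sum_add_distrib, Finset.sum_mul, Finset.mul_sum,
          ← Finset.sum_sub_distrib, Finset.smul_sum]
        refine Finset.sum_congr rfl fun j _ => ?_
        split_ifs <;> simp [pow_add, mul_smul, smul_sub]
      have hsyl := hK.commutator_eq hnk
      have h5 : c n * K n - K n * c n = beforeSubStep c k (n + 1) - beforeSubStep c k n := by
        rw [eq_sub_iff_add_eq]
        exact sub_eq_zero.1 hsyl
      rw [Finset.sum_apply, h3, h5, pow_add]
      simp only [mul_add, add_mul, mul_one, one_mul, smul_mul_assoc, mul_smul_comm]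
      module
    have h6 := (ih (by omega)).mul hf1
    have h7 := hS1.mul hrest
    simp only [mul_one, one_mul] at h6 h7
    refine (h6.add h7).congr_left fun ρ => ?_
    rw [List.prod_range_succ]
    change (F ρ * S ρ - S ρ * _) * _ + S ρ * _ = F ρ * (S ρ * _) - (S ρ * _) * _
    simp only [mul_sub, sub_mul, mul_assoc, sub_add_sub_cancel]

lemma stepTransform_zero (K : ℕ → Matrix (Fin m) (Fin m) ℂ) (k : ℕ) :
    stepTransform K k (0 : 𝕜) = 1 := by
  refine List.prod_eq_one fun x hx => ?_
  obtain ⟨l, hl, rfl⟩ := List.mem_map.1 hx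
  have : k + 1 - l ≠ 0 := by have := List.mem_range.1 hl; omega
  simp [this]

lemma analyticAt_stepTransform (K : ℕ → Matrix (Fin m) (Fin m) ℂ) (k : ℕ) :
    AnalyticAt 𝕜 (stepTransform K k : 𝕜 → Matrix (Fin m) (Fin m) ℂ) 0 := by
  have : ∀ n : ℕ, AnalyticAt 𝕜 (fun ρ : 𝕜 =>
      ((List.range n).map fun l => 1 + ρ ^ (k + 1 - l) • K l).prod) 0 := by
    intro n
    induction n with
    | zero => simpa using analyticAt_const
    | succ n ih =>
      simp only [List.prod_range_succ]
      exact ih.mul (analyticAt_const.add ((analyticAt_id.pow _).smul analyticAt_const))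
  exact this (k + 1)

lemma analyticAt_stepTransform_mul (K : ℕ → Matrix (Fin m) (Fin m) ℂ) (k : ℕ)
    (M : Matrix (Fin m) (Fin m) ℂ) : AnalyticAt 𝕜 (fun ρ : 𝕜 => stepTransform K k ρ * M) 0 :=
  (analyticAt_stepTransform K k).mul analyticAt_const

/-- One step keeps `Λ_0, …, Λ_k` and replaces the next coefficient by `M⁻¹ Λ̃_{k+1} M`. -/
lemma step_coeff {D : Set 𝕜} (hD : AccPt (0 : 𝕜) (𝓟 D)) {F : 𝕜 → Matrix (Fin m) (Fin m) ℂ}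
    {c K c' : ℕ → Matrix (Fin m) (Fin m) ℂ} {M : Matrix (Fin m) (Fin m) ℂ} {k : ℕ}
    (hF : HasAsympExpansion D F c) (hc : ∀ l ≤ k, (c l).IsDiag) (hK : SolvesSylvester c k K)
    (hM : IsUnit M) (hMb : IsBlockDiag (SameBlock c k) M)
    (hc' : HasAsympExpansion D
      (fun ρ => (stepTransform K k ρ * M)⁻¹ * F ρ * (stepTransform K k ρ * M)) c') :
    (∀ l ≤ k, c' l = c l) ∧ c' (k + 1) = M⁻¹ * lambdaTilde c k * M := by
  set Q : 𝕜 → Matrix (Fin m) (Fin m) ℂ := fun ρ => stepTransform K k ρ * M with hQ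
  have hQ0 : Q 0 = M := by simp [hQ, stepTransform_zero]
  have hQa : AnalyticAt 𝕜 Q 0 := analyticAt_stepTransform_mul K k M
  have hQi : AnalyticAt 𝕜 (fun ρ => (Q ρ)⁻¹) 0 := hQa.matrix_inv (hQ0 ▸ hM)
  have hMd : IsUnit M.det := (Matrix.isUnit_iff_isUnit_det _).1 hM
  have hQ1 : (fun ρ => (Q ρ)⁻¹) =O[𝓝[D] 0] (fun _ => (1 : 𝕜)) :=
    (hQi.continuousAt.tendsto.mono_left nhdsWithin_le_nhds).isBigO_one 𝕜
  have hM1 : (fun _ : 𝕜 => M) =O[𝓝[D] 0] (fun _ => (1 : 𝕜)) :=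
    isBigO_const_const _ one_ne_zero _
  have hmain := hQ1.mul ((hK.intertwine_isBigO hF hc (k + 1) le_rfl).mul hM1)
  simp only [mul_one, one_mul] at hmain
  have hunit : ∀ᶠ ρ in 𝓝[D] 0, IsUnit (Q ρ) :=
    eventually_isUnit_of_tendsto (hQa.continuousAt.tendsto.mono_left nhdsWithin_le_nhds)
      (hQ0 ▸ hM)
  set b : ℕ → Matrix (Fin m) (Fin m) ℂ := fun l => if l ≤ k then c l else M⁻¹ * lambdaTilde c k * M
    with hb
  have hexp : (fun ρ : 𝕜 => (Q ρ)⁻¹ * F ρ * Q ρ - ∑ j ∈ Finset.range (k + 1 + 1), ρ ^ j • b j)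
      =O[𝓝[D] 0] (fun ρ => ρ ^ (k + 1 + 1)) := by
    refine hmain.congr' ?_ EventuallyEq.rfl
    filter_upwards [hunit] with ρ hρ
    have hsum : ∑ j ∈ Finset.range (k + 1), ρ ^ j • b j =
        ∑ j ∈ Finset.range (k + 1), ρ ^ j • c j :=
      Finset.sum_congr rfl fun j hj => by
        rw [hb]; simp only [Nat.lt_succ_iff.1 (Finset.mem_range.1 hj), if_true]
    have hcomm : (∑ j ∈ Finset.range (k + 1), ρ ^ j • c j) * M =
        M * ∑ j ∈ Finset.range (k + 1), ρ ^ j • c j := by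
      rw [Finset.sum_mul, Finset.mul_sum]
      refine Finset.sum_congr rfl fun j hj => ?_
      have hj' := Nat.lt_succ_iff.1 (Finset.mem_range.1 hj)
      rw [smul_mul_assoc, mul_smul_comm, hMb.mul_comm hj' (hc j hj')]
    have hlast : b (k + 1) = M⁻¹ * lambdaTilde c k * M := by simp [hb]
    have hlam : lambdaTilde c k * M = M * b (k + 1) := by
      rw [hlast, ← mul_assoc, ← mul_assoc, Matrix.mul_nonsing_inv _ hMd, one_mul]
    have hdet : IsUnit (Q ρ).det := (Matrix.isUnit_iff_isUnit_det _).1 hρ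
    rw [Finset.sum_range_succ _ (k + 1), hsum]
    change (Q ρ)⁻¹ * ((F ρ * stepTransform K k ρ - stepTransform K k ρ *
      (∑ j ∈ Finset.range (k + 1), ρ ^ j • c j + ρ ^ (k + 1) • lambdaTilde c k)) * M) = _
    have h1 : (∑ j ∈ Finset.range (k + 1), ρ ^ j • c j + ρ ^ (k + 1) • lambdaTilde c k) * M =
        M * (∑ j ∈ Finset.range (k + 1), ρ ^ j • c j + ρ ^ (k + 1) • b (k + 1)) := by
      rw [add_mul, mul_add, hcomm, smul_mul_assoc, hlam, mul_smul_comm]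
    rw [sub_mul, mul_assoc (stepTransform K k ρ), h1, mul_assoc (F ρ), ← mul_assoc _ M]
    change (Q ρ)⁻¹ * (F ρ * Q ρ - Q ρ * _) = _
    rw [mul_sub, ← mul_assoc, ← mul_assoc (Q ρ)⁻¹ (Q ρ), Matrix.nonsing_inv_mul _ hdet, one_mul]
  refine ⟨fun l hl => ?_, ?_⟩
  · rw [hc'.eq_of_isBigO hD hexp (by omega : l ≤ k + 1)]
    simp [hb, hl]
  · rw [hc'.eq_of_isBigO hD hexp le_rfl]
    simp [hb]

end Step

/-! ### Convergent diagonalisers -/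

section Limit

variable {𝕜 : Type*} [RCLike 𝕜] {m : ℕ}

lemma isDiagonaliser_iff {M X : Matrix (Fin m) (Fin m) ℂ} :
    IsDiagonaliser M X ↔ IsUnit M ∧ ∃ d, X * M = M * Matrix.diagonal d := by
  refine and_congr_right fun hM => ?_
  have hd : IsUnit M.det := (Matrix.isUnit_iff_isUnit_det _).1 hM
  constructor
  · intro h
    refine ⟨(M⁻¹ * X * M).diag, ?_⟩
    rw [h.diagonal_diag, ← mul_assoc, ← mul_assoc, Matrix.mul_nonsing_inv _ hd, one_mul]
  · rintro ⟨d, h⟩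
    rw [mul_assoc, h, ← mul_assoc, Matrix.nonsing_inv_mul _ hd, one_mul]
    exact Matrix.isDiag_diagonal d

/-- Near `0` within `D` the matrices `F ρ` are diagonalised by matrices that converge to an
invertible matrix as `ρ → 0`. -/
def HasConvergentDiagonaliser (D : Set 𝕜) (F : 𝕜 → Matrix (Fin m) (Fin m) ℂ) : Prop :=
  ∃ (T : 𝕜 → Matrix (Fin m) (Fin m) ℂ) (T₀ : Matrix (Fin m) (Fin m) ℂ) (d : 𝕜 → Fin m → ℂ),
    Tendsto T (𝓝[D] 0) (𝓝 T₀) ∧ IsUnit T₀ ∧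
      ∀ᶠ ρ in 𝓝[D] 0, F ρ * T ρ = T ρ * Matrix.diagonal (d ρ)


lemma UniformlyDiagonableOn.hasConvergentDiagonaliser {D : Set 𝕜} (h0 : (0 : 𝕜) ∈ D)
    {A : 𝕜 → Matrix (Fin m) (Fin m) ℂ} {ε : ℝ} (hε : 0 < ε)
    (h : UniformlyDiagonableOn {ρ | ρ ∈ D ∧ ‖ρ‖ < ε} A) : HasConvergentDiagonaliser D A := by
  obtain ⟨T, hT, hdiag, -⟩ := h
  have hmem : (0 : 𝕜) ∈ {ρ | ρ ∈ D ∧ ‖ρ‖ < ε} := ⟨h0, by simpa using hε⟩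
  have hball : {ρ : 𝕜 | ρ ∈ D ∧ ‖ρ‖ < ε} ∈ 𝓝[D] (0 : 𝕜) := by
    filter_upwards [self_mem_nhdsWithin,
      mem_nhdsWithin_of_mem_nhds (Metric.ball_mem_nhds (0 : 𝕜) hε)] with ρ h1 h2
    exact ⟨h1, by simpa using h2⟩
  have hd : ∀ ρ, ∃ d : Fin m → ℂ, ρ ∈ {ρ | ρ ∈ D ∧ ‖ρ‖ < ε} →
      A ρ * T ρ = T ρ * Matrix.diagonal d := by
    intro ρ
    by_cases hρ : ρ ∈ {ρ | ρ ∈ D ∧ ‖ρ‖ < ε}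
    · obtain ⟨d, hd⟩ := (isDiagonaliser_iff.1 (hdiag ρ hρ)).2
      exact ⟨d, fun _ => hd⟩
    · exact ⟨0, fun h => absurd h hρ⟩
  choose d hd using hd
  exact ⟨T, T 0, d, (hT 0 hmem).mono_left (nhdsWithin_le_of_mem hball), (hdiag 0 hmem).1,
    by filter_upwards [hball] with ρ hρ using hd ρ hρ⟩

variable [NormedAlgebra 𝕜 ℂ]

/-- Convergence of the diagonalisers survives conjugation by a family with an invertible limit. -/
lemma HasConvergentDiagonaliser.conj {D : Set 𝕜} {F : 𝕜 → Matrix (Fin m) (Fin m) ℂ}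
    (hF : HasConvergentDiagonaliser D F) {Q : 𝕜 → Matrix (Fin m) (Fin m) ℂ}
    (hQ : AnalyticAt 𝕜 Q 0) (hQ0 : IsUnit (Q 0)) :
    HasConvergentDiagonaliser D (fun ρ => (Q ρ)⁻¹ * F ρ * Q ρ) := by
  obtain ⟨T, T₀, d, hT, hT₀, hd⟩ := hF
  have hQi := ((hQ.matrix_inv hQ0).continuousAt.tendsto.mono_left
    (nhdsWithin_le_nhds (s := D)))
  refine ⟨fun ρ => (Q ρ)⁻¹ * T ρ, (Q 0)⁻¹ * T₀, d, hQi.mul hT,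
    ((Matrix.isUnit_nonsing_inv_iff).2 hQ0).mul hT₀, ?_⟩
  filter_upwards [hd, eventually_isUnit_of_tendsto
    (hQ.continuousAt.tendsto.mono_left nhdsWithin_le_nhds) hQ0] with ρ hρ hu
  have hdet : IsUnit (Q ρ).det := (Matrix.isUnit_iff_isUnit_det _).1 hu
  rw [mul_assoc _ (Q ρ), ← mul_assoc (Q ρ), Matrix.mul_nonsing_inv _ hdet, one_mul, mul_assoc, hρ,
    mul_assoc]

/-- If `F ∼ Λ_0 + ⋯ + ρ^k Λ_k + ρ^{k+1} c_{k+1} + ⋯` has convergent diagonalisers, then their limit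
`T₀` diagonalises `Λ̃_{k+1}`. Row `i` of the eigenvalue equation of column `j`, divided by `ρ^{k+1}`,
has the limit `(c_{k+1} T₀)_{ij}`; hence the eigenvalue agrees with `∑ ρ^l λ_i^{[l]}` up to
`O(ρ^{k+1})` whenever `(T₀)_{ij} ≠ 0`. So each column of `T₀` lives in one block of `Π_k`, and
within this block the limit equations say that it is an eigenvector of `c_{k+1}`. -/
lemma HasConvergentDiagonaliser.exists_lambdaTilde_mul_eq {D : Set 𝕜}
    (hD : AccPt (0 : 𝕜) (𝓟 D)) {F : 𝕜 → Matrix (Fin m) (Fin m) ℂ}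
    (hdiag : HasConvergentDiagonaliser D F) {c : ℕ → Matrix (Fin m) (Fin m) ℂ} {k : ℕ}
    (hF : HasAsympExpansion D F c) (hc : ∀ l ≤ k, (c l).IsDiag) :
    ∃ (T₀ : Matrix (Fin m) (Fin m) ℂ) (μ : Fin m → ℂ), IsUnit T₀ ∧
      lambdaTilde c k * T₀ = T₀ * Matrix.diagonal μ ∧
      ∀ i i' j, T₀ i j ≠ 0 → T₀ i' j ≠ 0 → SameBlock c k i i' := by
  obtain ⟨T, T₀, d, hT, hT₀, hd⟩ := hdiag
  have : (𝓝[≠] (0 : 𝕜) ⊓ 𝓟 D).NeBot := hD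
  -- The point `ρ = 0`, where one cannot divide by `ρ ^ (k + 1)`, is removed from the filter.
  set L := 𝓝[≠] (0 : 𝕜) ⊓ 𝓟 D with hL
  have hle : L ≤ 𝓝[D] 0 := inf_le_inf_right _ nhdsWithin_le_nhds
  have hle0 : L ≤ 𝓝 0 := inf_le_left.trans nhdsWithin_le_nhds
  have hne : ∀ᶠ ρ in L, ρ ≠ 0 := mem_inf_of_left self_mem_nhdsWithin
  set lam : Fin m → 𝕜 → ℂ := fun i ρ => ∑ l ∈ Finset.range (k + 1), ρ ^ l • c l i i with hlam
  have hlim : Tendsto (fun ρ : 𝕜 => ((ρ ^ (k + 1))⁻¹ •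
      (F ρ - ∑ j ∈ Finset.range (k + 1), ρ ^ j • c j)) * T ρ) L (𝓝 (c (k + 1) * T₀)) := by
    refine Tendsto.mul ?_ (hT.mono_left hle)
    have h1 := (isBigO_refl (fun ρ : 𝕜 => (ρ ^ (k + 1))⁻¹) L).smul ((hF (k + 1)).mono hle)
    have h2 : Tendsto (fun ρ : 𝕜 => (ρ ^ (k + 1))⁻¹ • ρ ^ (k + 1 + 1)) L (𝓝 0) := by
      refine Tendsto.congr' ?_ (tendsto_id'.2 hle0)
      filter_upwards [hne] with ρ hρ
      rw [smul_eq_mul, pow_succ ρ (k + 1), inv_mul_cancel_left₀ (pow_ne_zero _ hρ), id]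
    have h3 := (h1.trans_tendsto h2).add_const (c (k + 1))
    rw [zero_add] at h3
    refine h3.congr' ?_
    filter_upwards [hne] with ρ hρ
    rw [Finset.sum_range_succ _ (k + 1), ← sub_sub, smul_sub _ _ (ρ ^ (k + 1) • c (k + 1)),
      smul_smul, inv_mul_cancel₀ (pow_ne_zero _ hρ), one_smul, sub_add_cancel]
  have hTij : ∀ i j, Tendsto (fun ρ => T ρ i j) L (𝓝 (T₀ i j)) := fun i j =>
    ((continuous_id.matrix_elem i j).tendsto T₀).comp (hT.mono_left hle)
  have hentry : ∀ i j, Tendsto (fun ρ => ((ρ ^ (k + 1))⁻¹ • (d ρ j - lam i ρ)) * T ρ i j) L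
      (𝓝 ((c (k + 1) * T₀) i j)) := by
    intro i j
    refine (((continuous_id.matrix_elem i j).tendsto _).comp hlim).congr' ?_
    filter_upwards [hle hd] with ρ hρ
    change (((ρ ^ (k + 1))⁻¹ •
      (F ρ - ∑ j ∈ Finset.range (k + 1), ρ ^ j • c j)) * T ρ) i j = _
    have hsum : (∑ l ∈ Finset.range (k + 1), (ρ ^ l • c l) * T ρ) i j = lam i ρ * T ρ i j := by
      rw [Matrix.sum_apply, hlam, Finset.sum_mul]
      refine Finset.sum_congr rfl fun l hl => ?_
      rw [smul_mul_assoc, Matrix.smul_apply,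
        (hc l (Nat.lt_succ_iff.1 (Finset.mem_range.1 hl))).mul_apply, smul_mul_assoc]
    rw [smul_mul_assoc, Matrix.smul_apply, sub_mul, Matrix.sub_apply, hρ, Matrix.mul_diagonal,
      Finset.sum_mul, hsum, smul_mul_assoc, sub_mul, mul_comm (T ρ i j)]
  have hquot : ∀ i j, T₀ i j ≠ 0 → Tendsto (fun ρ => (ρ ^ (k + 1))⁻¹ • (d ρ j - lam i ρ)) L
      (𝓝 ((c (k + 1) * T₀) i j / T₀ i j)) := by
    intro i j hij
    refine ((hentry i j).div (hTij i j) hij).congr' ?_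
    filter_upwards [(hTij i j).eventually_ne hij] with ρ hρ
    exact mul_div_cancel_right₀ _ hρ
  have hblock : ∀ i i' j, T₀ i j ≠ 0 → T₀ i' j ≠ 0 → SameBlock c k i i' := by
    intro i i' j hi hi' l hl
    -- The eigenvalue `d ρ j` cancels in the difference of the two quotients.
    have h1 := ((hquot i' j hi').sub (hquot i j hi)).isBigO_one 𝕜
    have h2 := (isBigO_refl (fun ρ : 𝕜 => ρ ^ (k + 1)) L).smul h1
    have h3 : (fun ρ : 𝕜 => ∑ l ∈ Finset.range (k + 1), ρ ^ l • (c l i i - c l i' i'))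
        =O[L] (fun ρ => ρ ^ (k + 1)) := by
      refine h2.congr' ?_ (Eventually.of_forall fun ρ => by simp)
      filter_upwards [hne] with ρ hρ
      rw [← smul_sub, smul_smul, mul_inv_cancel₀ (pow_ne_zero _ hρ), one_smul, hlam]
      simp only [smul_sub, Finset.sum_sub_distrib]
      ring
    exact sub_eq_zero.1 (eq_zero_of_sum_pow_smul_isBigO hD _
      (fun l => c l i i - c l i' i') h3 l (by omega))
  have hcol : ∀ j, ∃ i, T₀ i j ≠ 0 := by
    intro j
    by_contra! h
    exact ((Matrix.isUnit_iff_isUnit_det _).1 hT₀).ne_zero (Matrix.det_eq_zero_of_column_eq_zero j h)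
  choose i₀ hi₀ using hcol
  refine ⟨T₀, fun j => (c (k + 1) * T₀) (i₀ j) j / T₀ (i₀ j) j, hT₀, ?_, hblock⟩
  ext i j
  rw [Matrix.mul_diagonal, lambdaTilde, subStep_eq_bdiag]
  by_cases hi : SameBlock c k i (i₀ j)
  · have hrow : (bdiag (SameBlock c k) (c (k + 1)) * T₀) i j = (c (k + 1) * T₀) i j := by
      rw [Matrix.mul_apply, Matrix.mul_apply]
      refine Finset.sum_congr rfl fun i' _ => ?_
      by_cases h : T₀ i' j = 0
      · rw [h, mul_zero, mul_zero]
      · rw [bdiag_apply_of_rel (hi.trans (hblock _ _ j (hi₀ j) h))]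
    have hlam' : lam i = lam (i₀ j) := by
      funext ρ
      refine Finset.sum_congr rfl fun l hl => ?_
      rw [hi l (Nat.lt_succ_iff.1 (Finset.mem_range.1 hl))]
    have h1 := hentry i j
    rw [hlam'] at h1
    rw [hrow, mul_comm (T₀ i j)]
    exact tendsto_nhds_unique h1 ((hquot _ j (hi₀ j)).mul (hTij i j))
  · have hz : T₀ i j = 0 := by
      by_contra h
      exact hi (hblock _ _ j h (hi₀ j))
    rw [hz, zero_mul, Matrix.mul_apply]
    refine Finset.sum_eq_zero fun i' _ => ?_
    by_cases h : T₀ i' j = 0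
    · rw [h, mul_zero]
    · rw [bdiag_apply_of_not_rel (fun h' => hi (h'.trans (hblock _ _ j h (hi₀ j)))), zero_mul]

end Limit

/-! ### Arranging the eigenvalues -/

section Arrange

variable {m : ℕ}

/-- If the blocks of an equivalence relation are intervals, then any function can be sorted within
the blocks in such a way that equal values within a block become consecutive. -/
lemma exists_perm_grouping {r : Fin m → Fin m → Prop} (hr : Equivalence r)
    (hconv : ∀ i l j, i ≤ l → l ≤ j → r i j → r i l) (f : Fin m → ℂ) :
    ∃ σ : Equiv.Perm (Fin m), (∀ i, r (σ i) i) ∧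
      ∀ i l j, i ≤ l → l ≤ j → r i j → f (σ i) = f (σ j) → f (σ i) = f (σ l) := by
  classical
  -- The least element of the block of `i`.
  have hex : ∀ i, (Finset.univ.filter fun i' => r i i').Nonempty := fun i =>
    ⟨i, by simpa using hr.refl i⟩
  set b : Fin m → Fin m := fun i => (Finset.univ.filter fun i' => r i i').min' (hex i) with hb
  have hrb : ∀ i, r i (b i) := fun i => by
    simpa using Finset.min'_mem _ (hex i)
  have hbmin : ∀ i i', r i i' → b i ≤ i' := fun i i' h =>
    Finset.min'_le _ _ (by simpa using h)
  have hbr : ∀ i j, b i = b j → r i j := fun i j h =>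
    hr.trans (hrb i) (h ▸ hr.symm (hrb j))
  have hbmono : Monotone b := by
    intro i j hij
    by_contra! h
    have h1 : r (b j) i := hconv _ _ _ (h.le.trans (hbmin i i (hr.refl i))) hij (hr.symm (hrb j))
    exact h.not_ge (hbmin i (b j) (hr.symm h1))
  set key : Fin m → Fin m ×ₗ (ℝ ×ₗ ℝ) := fun i =>
    toLex (b i, toLex ((f i).re, (f i).im)) with hkey
  have hmono : Monotone (key ∘ Tuple.sort key) := Tuple.monotone_sort key
  set σ := Tuple.sort key
  have hbσmono : Monotone (b ∘ σ) := by
    intro i j hij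
    have h := hmono hij
    rcases (Prod.Lex.toLex_le_toLex (α := Fin m) (β := ℝ ×ₗ ℝ)).1 h with h | h
    · exact h.le
    · exact h.1.le
  -- Both `b` and `b ∘ σ` are monotone rearrangements of `b`, so `σ` preserves the blocks.
  have hbσ : b ∘ σ = b := by
    rw [Tuple.comp_sort_eq_comp_iff_monotone.2 hbσmono]
    exact (Tuple.comp_sort_eq_comp_iff_monotone (σ := 1).2 hbmono).symm
  refine ⟨σ, fun i => hbr _ _ (congrFun hbσ i), fun i l j hil hlj hij hf => ?_⟩
  have hbij : b (σ i) = b (σ j) := by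
    have h1 : b (σ i) = b i := congrFun hbσ i
    have h2 : b (σ j) = b j := congrFun hbσ j
    rw [h1, h2]
    refine le_antisymm (hbmin _ _ (hr.trans hij (hrb j)))
      (hbmin _ _ (hr.trans (hr.symm hij) (hrb i)))
  have hkij : key (σ i) = key (σ j) := by
    simp only [hkey, hbij, hf]
  have hkil : key (σ i) = key (σ l) :=
    le_antisymm (hmono hil) (hkij ▸ hmono hlj)
  have h := congrArg (fun x => ofLex (ofLex x).2) hkil
  simp only [hkey, ofLex_toLex, Prod.mk.injEq] at h
  exact Complex.ext h.1 h.2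

lemma Matrix.mul_submatrix_perm_eq {X T : Matrix (Fin m) (Fin m) ℂ} {μ : Fin m → ℂ}
    (h : X * T = T * Matrix.diagonal μ) (τ : Fin m → Fin m) :
    X * T.submatrix id τ = T.submatrix id τ * Matrix.diagonal (μ ∘ τ) := by
  ext i j
  have := congrFun (congrFun h i) (τ j)
  rw [Matrix.mul_diagonal] at this ⊢
  simpa [Matrix.mul_apply] using this

lemma Matrix.isUnit_submatrix_perm {T : Matrix (Fin m) (Fin m) ℂ} (hT : IsUnit T)
    (τ : Equiv.Perm (Fin m)) : IsUnit (T.submatrix id τ) := by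
  rw [Matrix.isUnit_iff_isUnit_det] at hT ⊢
  rw [Matrix.det_permute']
  exact IsUnit.mul (by rcases Int.units_eq_one_or τ.sign with h | h <;> simp [h]) hT

/-- If every column of an invertible matrix of eigenvectors lives in a single block, then its columns
can be permuted so as to give a block-diagonal diagonaliser whose eigenvalues are grouped. The Leibniz
formula supplies a permutation that moves each column into its own block. -/
lemma exists_blockDiag_diagonaliser {r : Fin m → Fin m → Prop} (hr : Equivalence r)
    (hconv : ∀ i l j, i ≤ l → l ≤ j → r i j → r i l) {X T : Matrix (Fin m) (Fin m) ℂ}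
    {μ : Fin m → ℂ} (hT : IsUnit T) (hX : X * T = T * Matrix.diagonal μ)
    (hcol : ∀ i i' j, T i j ≠ 0 → T i' j ≠ 0 → r i i') :
    ∃ (M : Matrix (Fin m) (Fin m) ℂ) (ν : Fin m → ℂ), IsUnit M ∧ IsBlockDiag r M ∧
      M⁻¹ * X * M = Matrix.diagonal ν ∧
      ∀ i l j, i ≤ l → l ≤ j → r i j → ν i = ν j → ν i = ν l := by
  have hdet : T.det ≠ 0 := ((Matrix.isUnit_iff_isUnit_det _).1 hT).ne_zero
  obtain ⟨π, hπ⟩ : ∃ π : Equiv.Perm (Fin m), ∀ i, T (π i) i ≠ 0 := by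
    by_contra! h
    refine hdet ?_
    rw [Matrix.det_apply]
    refine Finset.sum_eq_zero fun π _ => ?_
    obtain ⟨i, hi⟩ := h π
    exact smul_eq_zero_of_right _ (Finset.prod_eq_zero (Finset.mem_univ i) hi)
  obtain ⟨σ, hσ, hgroup⟩ := exists_perm_grouping hr hconv (fun i => μ (π.symm i))
  have hM : IsUnit (T.submatrix id (σ.trans π.symm)) := Matrix.isUnit_submatrix_perm hT _
  refine ⟨T.submatrix id (σ.trans π.symm), μ ∘ σ.trans π.symm, hM, ?_, ?_, hgroup⟩
  · intro i j hij
    by_contra h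
    have h1 : T (σ j) (π.symm (σ j)) ≠ 0 := by simpa using hπ (π.symm (σ j))
    exact hij (hr.trans (hcol _ _ _ h h1) (hσ j))
  · rw [mul_assoc, Matrix.mul_submatrix_perm_eq hX, ← mul_assoc,
      Matrix.nonsing_inv_mul _ ((Matrix.isUnit_iff_isUnit_det _).1 hM), one_mul]

lemma sameBlock_equivalence (c : ℕ → Matrix (Fin m) (Fin m) ℂ) (k : ℕ) :
    Equivalence (SameBlock c k) :=
  ⟨SameBlock.refl c k, SameBlock.symm, SameBlock.trans⟩

end Arrange

/-! ### Stages of the scheme -/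

section Stages

variable {𝕜 : Type*} [RCLike 𝕜] [NormedAlgebra 𝕜 ℂ] {m : ℕ}

lemma HasAsympExpansion.conj_const {D : Set 𝕜} {F : 𝕜 → Matrix (Fin m) (Fin m) ℂ}
    {c : ℕ → Matrix (Fin m) (Fin m) ℂ} (hF : HasAsympExpansion D F c)
    (P M : Matrix (Fin m) (Fin m) ℂ) :
    HasAsympExpansion D (fun ρ => P * F ρ * M) (fun j => P * c j * M) := by
  intro N
  have h := ((isBigO_const_const P (one_ne_zero (α := 𝕜)) (𝓝[D] (0 : 𝕜))).mul (hF N)).mul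
    (isBigO_const_const M (one_ne_zero (α := 𝕜)) (𝓝[D] (0 : 𝕜)))
  simp only [one_mul, mul_one] at h
  refine h.congr_left fun ρ => ?_
  simp only [mul_sub, sub_mul, Finset.mul_sum, Finset.sum_mul, mul_smul_comm, smul_mul_assoc]

lemma HasAsympExpansion.exists_conj {D : Set 𝕜} {F Q : 𝕜 → Matrix (Fin m) (Fin m) ℂ}
    {c : ℕ → Matrix (Fin m) (Fin m) ℂ} (hF : HasAsympExpansion D F c)
    (hQ : AnalyticAt 𝕜 Q 0) (hQ0 : IsUnit (Q 0)) :
    ∃ c', HasAsympExpansion D (fun ρ => (Q ρ)⁻¹ * F ρ * Q ρ) c' := by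
  obtain ⟨q, hq⟩ := hQ.exists_hasAsympExpansion (D := D)
  obtain ⟨p, hp⟩ := (hQ.matrix_inv hQ0).exists_hasAsympExpansion (D := D)
  exact ⟨_, (hp.mul hF).mul hq⟩

lemma HasAsympExpansion.coeff_unique {D : Set 𝕜} (hD : AccPt (0 : 𝕜) (𝓟 D))
    {F : 𝕜 → Matrix (Fin m) (Fin m) ℂ} {c c' : ℕ → Matrix (Fin m) (Fin m) ℂ}
    (hF : HasAsympExpansion D F c) (hF' : HasAsympExpansion D F c') : c = c' :=
  funext fun j => hF.eq_of_isBigO hD (hF' j) le_rfl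

/-- Whatever choices are made, at stage `k` the coefficients up to order `k` are diagonal and the
family still has convergent diagonalisers. -/
lemma SchemeStage.invariant {D : Set 𝕜} (hD : AccPt (0 : 𝕜) (𝓟 D))
    {A : 𝕜 → Matrix (Fin m) (Fin m) ℂ} {a : ℕ → Matrix (Fin m) (Fin m) ℂ}
    (hA : HasAsympExpansion D A a) (hdiag : HasConvergentDiagonaliser D A) {k : ℕ}
    {F : 𝕜 → Matrix (Fin m) (Fin m) ℂ} {c : ℕ → Matrix (Fin m) (Fin m) ℂ}
    (h : SchemeStage D A a k F c) :
    HasAsympExpansion D F c ∧ (∀ l ≤ k, (c l).IsDiag) ∧ HasConvergentDiagonaliser D F ∧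
      Grouped c k := by
  induction h with
  | zero M c hM hc hg =>
    refine ⟨hc, fun l hl => ?_, hdiag.conj (Q := fun _ => M) analyticAt_const hM.1, hg⟩
    rw [Nat.le_zero.1 hl, hc.coeff_unique hD (hA.conj_const M⁻¹ M)]
    exact hM.2
  | succ k F c _ K M c' hK hM hMb hc' hg ih =>
    obtain ⟨hF, hc, hFd, -⟩ := ih
    obtain ⟨h1, h2⟩ := step_coeff hD hF hc hK hM.1 hMb hc'
    refine ⟨hc', fun l hl => ?_, hFd.conj (analyticAt_stepTransform_mul K k M)
      (by rw [stepTransform_zero, one_mul]; exact hM.1), hg⟩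
    rcases Nat.le_succ_iff.1 hl with hl | rfl
    · rw [h1 l hl]; exact hc l hl
    · rw [h2]; exact hM.2

lemma exists_schemeStage {D : Set 𝕜} (hD : AccPt (0 : 𝕜) (𝓟 D))
    {A : 𝕜 → Matrix (Fin m) (Fin m) ℂ} {a : ℕ → Matrix (Fin m) (Fin m) ℂ}
    (hA : HasAsympExpansion D A a) (hdiag : HasConvergentDiagonaliser D A)
    (ha : Diagonable (a 0)) (k : ℕ) : ∃ F c, SchemeStage D A a k F c := by
  induction k with
  | zero =>
    obtain ⟨T, hT⟩ := ha
    obtain ⟨hTu, μ, hμ⟩ := isDiagonaliser_iff.1 hT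
    obtain ⟨M, ν, hM, -, hν, hg⟩ := exists_blockDiag_diagonaliser (r := fun _ _ => True)
      ⟨fun _ => trivial, fun _ => trivial, fun _ _ => trivial⟩ (fun _ _ _ _ _ _ => trivial)
      hTu hμ (fun _ _ _ _ _ => trivial)
    refine ⟨_, _, SchemeStage.zero M _ ⟨hM, hν ▸ Matrix.isDiag_diagonal ν⟩
      (hA.conj_const M⁻¹ M) fun i l j hil hlj hij n hn => ?_⟩
    have h := hij n hn
    rw [Nat.le_zero.1 hn] at h ⊢
    beta_reduce at h ⊢
    rw [hν, Matrix.diagonal_apply_eq, Matrix.diagonal_apply_eq] at h ⊢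
    exact hg i l j hil hlj trivial h
  | succ k ih =>
    obtain ⟨F, c, hS⟩ := ih
    obtain ⟨hF, hc, hFd, hgr⟩ := hS.invariant hD hA hdiag
    obtain ⟨T₀, μ, hT₀, hμ, hcol⟩ := hFd.exists_lambdaTilde_mul_eq hD hF hc
    obtain ⟨M, ν, hM, hMb, hν, hg⟩ :=
      exists_blockDiag_diagonaliser (sameBlock_equivalence c k) hgr hT₀ hμ hcol
    obtain ⟨K, hK⟩ := exists_solvesSylvester hc
    obtain ⟨c', hc'⟩ := hF.exists_conj (analyticAt_stepTransform_mul K k M)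
      (by rw [stepTransform_zero, one_mul]; exact hM)
    obtain ⟨h1, h2⟩ := step_coeff hD hF hc hK hM hMb hc'
    have hblock : ∀ i j, SameBlock c' (k + 1) i j ↔ SameBlock c k i j ∧ ν i = ν j := by
      intro i j
      rw [sameBlock_succ_iff, h2, hν, Matrix.diagonal_apply_eq, Matrix.diagonal_apply_eq]
      exact and_congr_left' (forall₂_congr fun l hl => by rw [h1 l hl])
    refine ⟨_, c', SchemeStage.succ k F c hS K M c' hK ⟨hM, hν ▸ Matrix.isDiag_diagonal ν⟩ hMb hc'
      fun i l j hil hlj hij => ?_⟩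
    rw [hblock] at hij ⊢
    exact ⟨hgr i l j hil hlj hij.1, hg i l j hil hlj hij.1 hij.2⟩

end Stages

theorem mainTheorem4 {𝕜 : Type*} [RCLike 𝕜] [NormedAlgebra 𝕜 ℂ] {m : ℕ}
    (D : Set 𝕜) (h0 : (0 : 𝕜) ∈ D) (hD : AccPt (0 : 𝕜) (Filter.principal D))
    (A : 𝕜 → Matrix (Fin m) (Fin m) ℂ) (a : ℕ → Matrix (Fin m) (Fin m) ℂ)
    (hA : HasAsympExpansion D A a)
    (ε : ℝ) (hε : 0 < ε)
    (hdiag : UniformlyDiagonableOn {ρ | ρ ∈ D ∧ ‖ρ‖ < ε} A) :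
    ∀ n : ℕ, AssumptionA D A a n := by
  have hconv := hdiag.hasConvergentDiagonaliser h0 hε
  -- The limit of `A` within `D` is taken over a set that contains `0` itself.
  have ha0 : A 0 = a 0 :=
    tendsto_nhds_unique (tendsto_pure_nhds _ _) (hA.tendsto.mono_left (pure_le_nhdsWithin h0))
  have ha : Diagonable (a 0) := by
    obtain ⟨T, -, hT, -⟩ := hdiag
    exact ⟨T 0, ha0 ▸ hT 0 ⟨h0, by simpa using hε⟩⟩
  intro n k _
  cases k with
  | zero => exact ⟨⟨a 0, rfl⟩, fun L hL => hL ▸ ha⟩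
  | succ k =>
    refine ⟨?_, ?_⟩
    · obtain ⟨F, c, hS⟩ := exists_schemeStage hD hA hconv ha k
      exact ⟨_, F, c, hS, rfl⟩
    · rintro L ⟨F, c, hS, rfl⟩
      obtain ⟨hF, hc, hFd, -⟩ := hS.invariant hD hA hconv
      obtain ⟨T₀, μ, hT₀, hμ, -⟩ := hFd.exists_lambdaTilde_mul_eq hD hF hc
      exact ⟨T₀, isDiagonaliser_iff.2 ⟨hT₀, μ, hμ⟩⟩
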